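/- All metric spaces are assumed to contain at least two points, balls $B(x,t)=\{y: d(x,y)<t\}$ are open, and $\operatorname{diam} X=\infty$ if $X$ is unbounded. For a metric space $(X,d)$ with a Borel regular measure $\nu$: (a) $X$ is Ahlfors $Q$-regular ($Q>0$) if there is $C\ge 1$ with $C^{-1}t^{Q}\le \nu(B(x,t))\le C t^{Q}$ for all $x\in X$ and $0<t<2\operatorname{diam}X$. (b) For $1\le p<\infty$ and $s>0$, the Besov space $B^s_{p,p}(X)$ is the normed space of all $u\in L^p(X)$ (real-valued, modulo equality $\nu$-a.e.) with $$\|u\|_{B^s_{p,p}(X)}=\|u\|_{L^p(X)}+\left(\int_X\int_X\frac{|u(x)-u(y)|^p}{d(x,y)^{sp}}\,\frac{d\nu(x)\,d\nu(y)}{\nu(B(x,d(x,y)))}\right)^{1/p}<\infty .$$ (c) A homeomorphism (onto) $f:(Z,d_Z)\to(W,d_W)$ is locally $(\theta_1,\theta_2,r)$-biHölder continuous, where $\theta_1,\theta_2>0$ and $0<r<2\operatorname{diam}Z$, if there is $C\ge1$ with $C^{-1}d_Z(x,y)^{\theta_1}\le d_W(f(x),f(y))\le C\,d_Z(x,y)^{\theta_2}$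 for all $x,y\in Z$ with $d_Z(x,y)<r$. **Theorem.** Let $(Z,d_Z,\nu_Z)$ be Ahlfors $Q_Z$-regular and $(W,d_W,\nu_W)$ be Ahlfors $Q_W$-regular, with $Q_Z,Q_W>0$, and let $\theta_1>0$, $\theta_2>0$, $s>0$, $s'>0$ and $1\le p<\infty$ satisfy $$Q_Z\ge\theta_1Q_W\quad\text{and}\quad s'\le\theta_2 s+\frac{\theta_2Q_W-Q_Z}{p}.$$ Let $f:Z\to W$ be locally $(\theta_1,\theta_2,r)$-biHölder continuous with $0<r<2\operatorname{diam}Z$. Then $f_{\#}(u)=u\circ f$ is well defined on $\nu_W$-a.e. equivalence classes and is a bounded injective linear map $f_{\#}:B^s_{p,p}(W)\to B^{s'}_{p,p}(Z)$. -/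

import Mathlib

open MeasureTheory Metric Set
open scoped ENNReal

section AhlforsRegular

variable {Z : Type*} [MetricSpace Z] [MeasurableSpace Z]

/-- `ν` is Ahlfors `Q`-regular: `C⁻¹ r ^ Q ≤ ν (B(z, r)) ≤ C r ^ Q` for all `z` and all
`0 < r < 2 diam Z`, where `diam Z` is `∞` if `Z` is unbounded. -/
def IsAhlforsRegular (ν : Measure Z) (Q : ℝ) : Prop :=
  ∃ C : ℝ, 1 ≤ C ∧ ∀ (z : Z) (r : ℝ), 0 < r → ENNReal.ofReal r < 2 * ediam (univ : Set Z) →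
    ENNReal.ofReal (C⁻¹ * r ^ Q) ≤ ν (ball z r) ∧ ν (ball z r) ≤ ENNReal.ofReal (C * r ^ Q)

namespace IsAhlforsRegular

variable {ν : Measure Z} {Q : ℝ}

theorem measure_ball_lt_top [Nontrivial Z] (h : IsAhlforsRegular ν Q) (z : Z) (r : ℝ) :
    ν (ball z r) < ∞ := by
  obtain ⟨C, -, hC⟩ := h
  by_cases hb : ediam (univ : Set Z) = ∞
  · rcases le_or_gt r 0 with hr | hr
    · simp [ball_eq_empty.2 hr]
    · exact ((hC z r hr (by simp [hb])).2).trans_lt ENNReal.ofReal_lt_top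
  · have hpos : 0 < ediam (univ : Set Z) := ediam_pos_iff.2 nontrivial_univ
    obtain ⟨D, hD1, hD2⟩ : ∃ D, ediam (univ : Set Z) < D ∧ D < 2 * ediam (univ : Set Z) := by
      apply exists_between
      rw [two_mul]
      exact ENNReal.lt_add_right hb hpos.ne'
    have hDt : D ≠ ∞ := hD2.ne_top
    have hsub : ball z r ⊆ ball z D.toReal := by
      intro y _
      rw [mem_ball, dist_edist]
      exact (ENNReal.toReal_lt_toReal (edist_ne_top _ _) hDt).2
        ((edist_le_ediam_of_mem (mem_univ y) (mem_univ z)).trans_lt hD1)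
    refine (measure_mono hsub).trans_lt (((hC z D.toReal
      (ENNReal.toReal_pos (hpos.trans hD1).ne' hDt) ?_).2).trans_lt ENNReal.ofReal_lt_top)
    rwa [ENNReal.ofReal_toReal hDt]

theorem measure_ball_pos [Nontrivial Z] (h : IsAhlforsRegular ν Q) (z : Z) {r : ℝ} (hr : 0 < r) :
    0 < ν (ball z r) := by
  obtain ⟨C, hC1, hC⟩ := h
  have hpos : 0 < 2 * ediam (univ : Set Z) :=
    ENNReal.mul_pos (by simp) (ediam_pos_iff.2 nontrivial_univ).ne'
  obtain ⟨D, hD0, hD⟩ := exists_between hpos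
  have hDt : D ≠ ∞ := hD.ne_top
  have hD0' := ENNReal.toReal_pos hD0.ne' hDt
  have hm : 0 < min r D.toReal := lt_min hr hD0'
  have h1 := (hC z (min r D.toReal) hm (lt_of_le_of_lt
    ((ENNReal.ofReal_le_ofReal (min_le_right _ _)).trans_eq (ENNReal.ofReal_toReal hDt)) hD)).1
  have h2 : (0 : ℝ≥0∞) < ENNReal.ofReal (C⁻¹ * (min r D.toReal) ^ Q) := by
    rw [ENNReal.ofReal_pos]
    have : 0 < C := by linarith
    positivity
  exact (h2.trans_le h1).trans_le (measure_mono (ball_subset_ball (min_le_left _ _)))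

theorem sigmaFinite [Nontrivial Z] (h : IsAhlforsRegular ν Q) : SigmaFinite ν := by
  obtain ⟨z⟩ : Nonempty Z := inferInstance
  exact ⟨⟨⟨fun n => ball z n, fun _ => trivial, fun n => h.measure_ball_lt_top z n,
    iUnion_ball_nat z⟩⟩⟩

theorem secondCountableTopology [Nontrivial Z] [BorelSpace Z] (h : IsAhlforsRegular ν Q) :
    SecondCountableTopology Z := by
  have := h.sigmaFinite
  refine secondCountable_of_almost_dense_set fun ε hε => ?_
  obtain ⟨s, hs⟩ := zorn_subset {s : Set Z | s.Pairwise fun x y => ε < dist x y} (by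
    intro c hc hchain
    refine ⟨⋃₀ c, ?_, fun t ht => subset_sUnion_of_mem ht⟩
    exact (pairwise_sUnion hchain.directedOn).2 fun t ht => hc ht)
  refine ⟨s, ?_, fun x => ?_⟩
  · have hcount := Measure.countable_meas_pos_of_disjoint_iUnion (μ := ν)
      (As := fun x : s => ball (x : Z) (ε / 2)) (fun x => isOpen_ball.measurableSet) (by
        intro x y hxy
        apply ball_disjoint_ball
        have := hs.prop x.2 y.2 (fun h => hxy (Subtype.ext h))
        linarith)
    have : {x : s | 0 < ν (ball (x : Z) (ε / 2))} = univ :=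
      eq_univ_of_forall fun x => h.measure_ball_pos _ (half_pos hε)
    rw [this] at hcount
    exact countable_coe_iff.1 (countable_univ_iff.1 hcount)
  · by_contra! hx
    have hins : insert x s ∈ {s : Set Z | s.Pairwise fun x y => ε < dist x y} := by
      refine hs.prop.insert fun y hy _ => ⟨hx y hy, ?_⟩
      rw [dist_comm]
      exact hx y hy
    have hxs : x ∈ s := hs.le_of_ge hins (subset_insert x s) (mem_insert x s)
    have := hx x hxs
    rw [dist_self] at this
    linarith

end IsAhlforsRegular

end AhlforsRegular

/-- The bounds that make a homeomorphism locally `(θ₁, θ₂, r)`-biHölder continuous. -/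
def IsLocallyBiHolder {Z W : Type*} [MetricSpace Z] [MetricSpace W] (f : Z ≃ₜ W)
    (θ₁ θ₂ r : ℝ) : Prop :=
  ∃ C : ℝ, 1 ≤ C ∧ ∀ x y : Z, dist x y < r →
    C⁻¹ * dist x y ^ θ₁ ≤ dist (f x) (f y) ∧ dist (f x) (f y) ≤ C * dist x y ^ θ₂

noncomputable section Besov

variable {Z : Type*} [MetricSpace Z] [MeasurableSpace Z]

/-- The homogeneous Besov (semi)norm of `u`, with values in `[0, ∞]`. The integrand is `0` on the
diagonal, by the conventions for division in `[0, ∞]`. -/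
def besovSeminorm (s p : ℝ) (ν : Measure Z) (u : Z → ℝ) : ℝ≥0∞ :=
  (∫⁻ y, ∫⁻ x, ENNReal.ofReal |u x - u y| ^ p / edist x y ^ (s * p) / ν (ball x (dist x y)) ∂ν ∂ν)
    ^ (1 / p)

/-- An auxiliary weighted measure on `Z × Z`, used only to check the norm axioms. -/
def besovMeasure (s p : ℝ) (ν : Measure Z) : Measure (Z × Z) :=
  (ν.prod ν).withDensity
    fun z => (edist z.1 z.2 ^ (s * p))⁻¹ * (ν (ball z.1 (dist z.1 z.2)))⁻¹

theorem besovSeminorm_congr {s p : ℝ} {ν : Measure Z} {u v : Z → ℝ} (h : u =ᵐ[ν] v) :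
    besovSeminorm s p ν u = besovSeminorm s p ν v := by
  unfold besovSeminorm
  congr 1
  refine lintegral_congr_ae ?_
  filter_upwards [h] with y hy
  refine lintegral_congr_ae ?_
  filter_upwards [h] with x hx
  rw [hx, hy]

theorem besovSeminorm_eq [BorelSpace Z] [SecondCountableTopology Z] {ν : Measure Z} [SFinite ν]
    (s : ℝ) {p : ℝ} (hp : 1 ≤ p) {u : Z → ℝ} (hu : Measurable u) :
    besovSeminorm s p ν u =
      eLpNorm (fun z : Z × Z => u z.1 - u z.2) (ENNReal.ofReal p) (besovMeasure s p ν) := by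
  have hp0 : 0 < p := by linarith
  have hball : Measurable fun z : Z × Z => ν (ball z.1 (dist z.1 z.2)) := by
    have hm : MeasurableSet {q : (Z × Z) × Z | dist q.2 q.1.1 < dist q.1.1 q.1.2} :=
      measurableSet_lt (by fun_prop) (by fun_prop)
    exact measurable_measure_prodMk_left hm
  have hk : Measurable fun z : Z × Z =>
      (edist z.1 z.2 ^ (s * p))⁻¹ * (ν (ball z.1 (dist z.1 z.2)))⁻¹ :=
    (Measurable.pow_const (by fun_prop) _).inv.mul hball.inv
  have hd : Measurable fun z : Z × Z => ‖u z.1 - u z.2‖ₑ ^ p := by fun_prop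
  rw [eLpNorm_eq_lintegral_rpow_enorm_toReal (by simpa using hp0) ENNReal.ofReal_ne_top,
    ENNReal.toReal_ofReal hp0.le, besovMeasure, lintegral_withDensity_eq_lintegral_mul _ hk hd,
    lintegral_prod_symm' _ (hk.mul hd), besovSeminorm]
  congr 1
  refine lintegral_congr fun y => lintegral_congr fun x => ?_
  simp only [Pi.mul_apply, div_eq_mul_inv, Real.enorm_eq_ofReal_abs]
  ring

variable [BorelSpace Z] [Nontrivial Z] {ν : Measure Z} {Q : ℝ}

theorem besovSeminorm_add_le (hν : IsAhlforsRegular ν Q) (s : ℝ) {p : ℝ} (hp : 1 ≤ p)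
    (u v : Lp ℝ (ENNReal.ofReal p) ν) :
    besovSeminorm s p ν ⇑(u + v) ≤ besovSeminorm s p ν u + besovSeminorm s p ν v := by
  have := hν.sigmaFinite
  have := hν.secondCountableTopology
  have hu := (Lp.stronglyMeasurable u).measurable
  have hv := (Lp.stronglyMeasurable v).measurable
  rw [besovSeminorm_congr (Lp.coeFn_add u v), besovSeminorm_eq s hp (hu.add hv),
    besovSeminorm_eq s hp hu, besovSeminorm_eq s hp hv]
  have hfun : (fun z : Z × Z => (⇑u + ⇑v) z.1 - (⇑u + ⇑v) z.2) =
      (fun z : Z × Z => u z.1 - u z.2) + fun z : Z × Z => v z.1 - v z.2 := by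
    funext z
    simp only [Pi.add_apply]
    ring
  rw [hfun]
  exact eLpNorm_add_le (by fun_prop) (by fun_prop) (by simpa using hp)

theorem besovSeminorm_smul (hν : IsAhlforsRegular ν Q) (s : ℝ) {p : ℝ} (hp : 1 ≤ p)
    (c : ℝ) (u : Lp ℝ (ENNReal.ofReal p) ν) :
    besovSeminorm s p ν ⇑(c • u) = ENNReal.ofReal |c| * besovSeminorm s p ν u := by
  have := hν.sigmaFinite
  have := hν.secondCountableTopology
  have hu := (Lp.stronglyMeasurable u).measurable
  rw [besovSeminorm_congr (Lp.coeFn_smul c u), besovSeminorm_eq s hp (hu.const_smul c),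
    besovSeminorm_eq s hp hu]
  have hfun : (fun z : Z × Z => (c • ⇑u) z.1 - (c • ⇑u) z.2) =
      c • fun z : Z × Z => u z.1 - u z.2 := by
    funext z
    simp only [Pi.smul_apply, smul_eq_mul]
    ring
  rw [hfun, eLpNorm_const_smul, Real.enorm_eq_ofReal_abs]

theorem besovSeminorm_zero (hν : IsAhlforsRegular ν Q) (s : ℝ) {p : ℝ} (hp : 1 ≤ p) :
    besovSeminorm s p ν ⇑(0 : Lp ℝ (ENNReal.ofReal p) ν) = 0 := by
  have h := besovSeminorm_smul hν s hp 0 0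
  rw [zero_smul, abs_zero, ENNReal.ofReal_zero, zero_mul] at h
  exact h

/-- The elements of `L^p(Z)` with finite homogeneous Besov norm. The regularity of `ν` and
`1 ≤ p` serve to show that they form a linear subspace. -/
def besovSubmodule (hν : IsAhlforsRegular ν Q) (s : ℝ) {p : ℝ} (hp : 1 ≤ p) :
    Submodule ℝ (Lp ℝ (ENNReal.ofReal p) ν) where
  carrier := {u | besovSeminorm s p ν u < ∞}
  zero_mem' := by
    change besovSeminorm s p ν ⇑(0 : Lp ℝ (ENNReal.ofReal p) ν) < ∞
    rw [besovSeminorm_zero hν s hp]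
    exact ENNReal.zero_lt_top
  add_mem' {u v} hu hv :=
    (besovSeminorm_add_le hν s hp u v).trans_lt (ENNReal.add_lt_top.2 ⟨hu, hv⟩)
  smul_mem' c u hu := by
    change besovSeminorm s p ν ⇑(c • u) < ∞
    rw [besovSeminorm_smul hν s hp c u]
    exact ENNReal.mul_lt_top ENNReal.ofReal_lt_top hu

/-- The Besov space `B^s_{p,p}(Z)`; a type of its own, since its norm is not the `L^p` norm. -/
def BesovSpace (hν : IsAhlforsRegular ν Q) (s : ℝ) {p : ℝ} (hp : 1 ≤ p) : Type _ :=
  ↥(besovSubmodule hν s hp)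

namespace BesovSpace

variable {hν : IsAhlforsRegular ν Q} {s p : ℝ} {hp : 1 ≤ p}

instance : AddCommGroup (BesovSpace hν s hp) :=
  inferInstanceAs (AddCommGroup ↥(besovSubmodule hν s hp))

instance : Module ℝ (BesovSpace hν s hp) :=
  inferInstanceAs (Module ℝ ↥(besovSubmodule hν s hp))

/-- The inclusion `B^s_{p,p}(Z) → L^p(Z)`. -/
def toLp : BesovSpace hν s hp →ₗ[ℝ] Lp ℝ (ENNReal.ofReal p) ν :=
  (besovSubmodule hν s hp).subtype

theorem seminorm_toLp_ne_top (u : BesovSpace hν s hp) : besovSeminorm s p ν (toLp u) ≠ ∞ :=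
  LT.lt.ne u.2

/-- The norm `‖u‖_{L^p} + ‖u‖_{\dot B^s_{p,p}}`. -/
instance : NormedAddCommGroup (BesovSpace hν s hp) :=
  have : Fact (1 ≤ ENNReal.ofReal p) := ⟨by simpa using hp⟩
  AddGroupNorm.toNormedAddCommGroup
    { toFun := fun u => ‖toLp u‖ + (besovSeminorm s p ν (toLp u)).toReal
      map_zero' := by
        rw [map_zero, besovSeminorm_zero hν s hp]
        simp
      add_le' := fun u v => by
        have h1 := norm_add_le (toLp u) (toLp v)
        have h2 := ENNReal.toReal_mono
          (ENNReal.add_ne_top.2 ⟨seminorm_toLp_ne_top u, seminorm_toLp_ne_top v⟩)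
          (besovSeminorm_add_le hν s hp (toLp u) (toLp v))
        rw [ENNReal.toReal_add (seminorm_toLp_ne_top u) (seminorm_toLp_ne_top v)] at h2
        rw [map_add]
        linarith
      neg' := fun u => by
        have h := besovSeminorm_smul hν s hp (-1) (toLp u)
        rw [neg_one_smul] at h
        rw [map_neg, h, norm_neg]
        simp
      eq_zero_of_map_eq_zero' := fun u hu => by
        have h : ‖toLp u‖ = 0 := le_antisymm
          (by linarith [ENNReal.toReal_nonneg (a := besovSeminorm s p ν (toLp u))]) (norm_nonneg _)
        exact Subtype.ext (norm_eq_zero.1 h) }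

theorem norm_def (u : BesovSpace hν s hp) :
    ‖u‖ = ‖toLp u‖ + (besovSeminorm s p ν (toLp u)).toReal := rfl

instance : NormedSpace ℝ (BesovSpace hν s hp) where
  norm_smul_le c u := by
    have : Fact (1 ≤ ENNReal.ofReal p) := ⟨by simpa using hp⟩
    rw [norm_def, norm_def, map_smul, besovSeminorm_smul hν s hp, norm_smul, ENNReal.toReal_mul,
      ENNReal.toReal_ofReal (abs_nonneg c), Real.norm_eq_abs, mul_add]

end BesovSpace

end Besov

/-! Everything rests on the one-sided comparison `νZ.map f ≤ K • νW`. The lower Hölder bound puts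
the preimage of a small ball of radius ρ inside a ball of radius about ρ^(1/θ₁), of measure at most
a constant times ρ^(QZ/θ₁) ≤ ρ^QW. A Vitali covering passes from balls to open sets, and outer
regularity to Borel sets. This makes composition well defined on classes and bounded on L^p.

For the seminorm, regularity makes the kernels comparable to d^(-(s'p+QZ)) on Z and d^(-(sp+QW)) on
W, and the condition on s' says s'p + QZ ≤ θ₂(sp + QW). Hence at distances below r the upper Hölder
bound dominates the kernel of Z by that of W. At distances at least r, |a - b|^p is at most
2^(p-1)(|a|^p + |b|^p), and the kernel has uniformly bounded tails, so the L^p norm controls that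
part.

Injectivity does not follow from the measure comparison, since a set of positive `νW` measure may
have a null preimage. But if u ∘ f = 0 a.e. and u(f x) ≠ 0, the Besov integral of u at f x, pulled
back to the ball B(x, t), is at least c t^(QZ - θ₂(sp+QW)). The exponent is negative, so this blows
up as t → 0, whereas the integral is finite at almost every point of W. -/

/-- Makes Ahlfors regularity applicable at the radius d(x, y) occurring in the Besov kernel. -/
theorem ofReal_dist_lt_two_mul_ediam {Z : Type*} [MetricSpace Z] {x y : Z} (h : x ≠ y) :
    ENNReal.ofReal (dist x y) < 2 * ediam (univ : Set Z) := by
  have hle : ENNReal.ofReal (dist x y) ≤ ediam (univ : Set Z) := by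
    rw [← edist_dist]
    exact edist_le_ediam_of_mem (mem_univ x) (mem_univ y)
  have hpos : 0 < ENNReal.ofReal (dist x y) := ENNReal.ofReal_pos.2 (dist_pos.2 h)
  rcases eq_or_ne (ediam (univ : Set Z)) ∞ with hb | hb
  · simp [hb]
  · refine hle.trans_lt ?_
    rw [two_mul]
    exact ENNReal.lt_add_right hb (hpos.trans_le hle).ne'

/-! ### Consequences of Ahlfors regularity: balls, kernels, tails. -/

namespace IsAhlforsRegular

variable {Z : Type*} [MetricSpace Z] [MeasurableSpace Z] {ν : Measure Z} {Q : ℝ}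

/-- The upper bound in Ahlfors regularity extends to all radii. -/
theorem exists_bounds [Nontrivial Z] (h : IsAhlforsRegular ν Q) (hQ : 0 < Q) :
    ∃ C : ℝ, 1 ≤ C ∧
      (∀ (z : Z) (t : ℝ), 0 < t → ENNReal.ofReal t < 2 * ediam (univ : Set Z) →
        ENNReal.ofReal (C⁻¹ * t ^ Q) ≤ ν (ball z t)) ∧
      ∀ (z : Z) (t : ℝ), 0 < t → ν (ball z t) ≤ ENNReal.ofReal (C * t ^ Q) := by
  obtain ⟨C, hC1, hC⟩ := h
  refine ⟨C, hC1, fun z t ht ht' => (hC z t ht ht').1, fun z t ht => ?_⟩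
  by_cases ht' : ENNReal.ofReal t < 2 * ediam (univ : Set Z)
  · exact (hC z t ht ht').2
  rw [not_lt] at ht'
  have hb : ediam (univ : Set Z) ≠ ∞ := by
    intro hb
    simp [hb] at ht'
  have hpos : 0 < ediam (univ : Set Z) := ediam_pos_iff.2 nontrivial_univ
  -- A ball of radius t ≥ 2 diam lies in one of radius D ≤ t, which is the whole space yet still in
  -- the range of regularity.
  obtain ⟨D, hD1, hD2⟩ : ∃ D, ediam (univ : Set Z) < D ∧ D < 2 * ediam (univ : Set Z) := by
    apply exists_between
    rw [two_mul]
    exact ENNReal.lt_add_right hb hpos.ne'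
  have hDt : D ≠ ∞ := hD2.ne_top
  have hD0 : 0 < D.toReal := ENNReal.toReal_pos (hpos.trans hD1).ne' hDt
  have hsub : ball z t ⊆ ball z D.toReal := by
    intro y _
    rw [mem_ball, dist_edist]
    exact (ENNReal.toReal_lt_toReal (edist_ne_top _ _) hDt).2
      ((edist_le_ediam_of_mem (mem_univ y) (mem_univ z)).trans_lt hD1)
  have hDt' : D.toReal ≤ t := ENNReal.toReal_le_of_le_ofReal ht.le (hD2.le.trans ht')
  refine (measure_mono hsub).trans ((hC z _ hD0 (by rwa [ENNReal.ofReal_toReal hDt])).2.trans ?_)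
  gcongr

/-- The Besov kernel is comparable to a power of the distance. -/
theorem exists_kernel_bounds (h : IsAhlforsRegular ν Q) :
    ∃ C : ℝ, 1 ≤ C ∧ ∀ (a : ℝ≥0∞) (t : ℝ) (x y : Z), x ≠ y →
      a * ENNReal.ofReal (C⁻¹ * dist x y ^ (-(t + Q))) ≤
        a / edist x y ^ t / ν (ball x (dist x y)) ∧
      a / edist x y ^ t / ν (ball x (dist x y)) ≤
        a * ENNReal.ofReal (C * dist x y ^ (-(t + Q))) := by
  obtain ⟨C, hC1, hC⟩ := h
  have hC0 : 0 < C := by linarith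
  refine ⟨C, hC1, fun a t x y hxy => ?_⟩
  have hd : 0 < dist x y := dist_pos.2 hxy
  obtain ⟨h1, h2⟩ := hC x _ hd (ofReal_dist_lt_two_mul_ediam hxy)
  have e1 : ∀ c : ℝ, 0 < c → (ENNReal.ofReal (dist x y) ^ t)⁻¹ *
      (ENNReal.ofReal (c⁻¹ * dist x y ^ Q))⁻¹ = ENNReal.ofReal (c * dist x y ^ (-(t + Q))) := by
    intro c hc
    rw [ENNReal.ofReal_rpow_of_pos hd, ← ENNReal.ofReal_inv_of_pos (by positivity),
      ← ENNReal.ofReal_inv_of_pos (by positivity), ← ENNReal.ofReal_mul (by positivity),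
      Real.rpow_neg hd.le, Real.rpow_add hd]
    congr 1
    field_simp
  rw [div_eq_mul_inv, div_eq_mul_inv, mul_assoc, edist_dist, ← e1 C hC0, ← e1 C⁻¹ (by positivity),
    inv_inv]
  constructor <;> gcongr

/-- Uniform bound for the tails of the kernel `d(x, y) ^ (-(a + Q))`. -/
theorem exists_tail_bound [Nontrivial Z] [BorelSpace Z] (h : IsAhlforsRegular ν Q) (hQ : 0 < Q)
    {a r : ℝ} (ha : 0 < a) (hr : 0 < r) :
    ∃ K : ℝ≥0∞, K ≠ ∞ ∧ ∀ x : Z,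
      ∫⁻ y in {y | r ≤ dist y x}, ENNReal.ofReal (dist y x ^ (-(a + Q))) ∂ν ≤ K := by
  obtain ⟨C, hC1, -, hC⟩ := h.exists_bounds hQ
  have hC0 : 0 < C := by linarith
  -- Ratio of the geometric series over dyadic annuli: the k-th contributes at most (2^k r)^(-(a+Q))
  -- · C (2^(k+1) r)^Q.
  set q : ℝ := 2 ^ (-a) with hq
  have hq0 : 0 < q := by positivity
  have hq1 : q < 1 := Real.rpow_lt_one_of_one_lt_of_neg one_lt_two (by linarith)
  have hsum : Summable fun k : ℕ => C * 2 ^ Q * r ^ (-a) * q ^ k :=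
    (summable_geometric_of_lt_one hq0.le hq1).mul_left _
  refine ⟨∑' k : ℕ, ENNReal.ofReal (C * 2 ^ Q * r ^ (-a) * q ^ k), hsum.tsum_ofReal_ne_top,
    fun x => ?_⟩
  let A : ℕ → Set Z := fun k => {y | 2 ^ k * r ≤ dist y x} ∩ ball x (2 ^ (k + 1) * r)
  have hA : ∀ k, MeasurableSet (A k) := fun k =>
    (isClosed_le continuous_const (by fun_prop)).measurableSet.inter isOpen_ball.measurableSet
  have hcov : {y | r ≤ dist y x} ⊆ ⋃ k, A k := by
    intro y hy
    obtain ⟨k, hk1, hk2⟩ := exists_nat_pow_near ((one_le_div hr).2 hy) one_lt_two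
    rw [le_div_iff₀ hr] at hk1
    rw [div_lt_iff₀ hr] at hk2
    exact mem_iUnion.2 ⟨k, hk1, hk2⟩
  refine (lintegral_mono_set hcov).trans ((lintegral_iUnion_le _ _).trans
    (ENNReal.tsum_le_tsum fun k => ?_))
  have hR : 0 < 2 ^ k * r := by positivity
  calc ∫⁻ y in A k, ENNReal.ofReal (dist y x ^ (-(a + Q))) ∂ν
      ≤ ∫⁻ _ in A k, ENNReal.ofReal ((2 ^ k * r) ^ (-(a + Q))) ∂ν := by
        refine setLIntegral_mono' (hA k) fun y hy => ENNReal.ofReal_le_ofReal ?_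
        exact Real.rpow_le_rpow_of_nonpos hR hy.1 (by linarith)
    _ = ENNReal.ofReal ((2 ^ k * r) ^ (-(a + Q))) * ν (A k) := setLIntegral_const _ _
    _ ≤ ENNReal.ofReal ((2 ^ k * r) ^ (-(a + Q))) *
          ENNReal.ofReal (C * (2 ^ (k + 1) * r) ^ Q) := by
        gcongr
        exact (measure_mono inter_subset_right).trans (hC x _ (by positivity))
    _ = ENNReal.ofReal (C * 2 ^ Q * r ^ (-a) * q ^ k) := by
        rw [← ENNReal.ofReal_mul (by positivity)]
        congr 1
        have e1 : (2 : ℝ) ^ (k + 1) * r = 2 * (2 ^ k * r) := by ring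
        have e2 : q ^ k = ((2 : ℝ) ^ k) ^ (-a) := by
          rw [hq, ← Real.rpow_natCast, ← Real.rpow_natCast, ← Real.rpow_mul (by norm_num),
            ← Real.rpow_mul (by norm_num), mul_comm]
        have e3 : (2 ^ k * r) ^ (-(a + Q)) * (2 ^ k * r) ^ Q = (2 ^ k * r) ^ (-a) := by
          rw [← Real.rpow_add hR]
          congr 1
          ring
        rw [e1, e2, Real.mul_rpow (by norm_num) hR.le, mul_assoc (C * 2 ^ Q), mul_comm (r ^ (-a)),
          ← Real.mul_rpow (by positivity) hr.le, ← e3]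
        ring

end IsAhlforsRegular

/-! ### Domination of the push-forward measure. -/

section MapLe

variable {Z W : Type*} [MetricSpace Z] [MeasurableSpace Z] [Nontrivial Z]
  [MetricSpace W] [MeasurableSpace W] [Nontrivial W]
  {νZ : Measure Z} {νW : Measure W} {QZ QW θ₁ θ₂ r : ℝ} {f : Z ≃ₜ W}

/-- Preimages of small balls under a locally biHölder homeomorphism have controlled measure. -/
theorem IsLocallyBiHolder.exists_measure_preimage_closedBall_le
    (hf : IsLocallyBiHolder f θ₁ θ₂ r) (hr : 0 < r) (hQZ : 0 < QZ) (hθ₁ : 0 < θ₁)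
    (hQ : θ₁ * QW ≤ QZ) (hZ : IsAhlforsRegular νZ QZ) (hW : IsAhlforsRegular νW QW) :
    ∃ K : ℝ≥0∞, K ≠ 0 ∧ K ≠ ∞ ∧ ∀ w : W, ∃ ε > 0, ∀ ρ : ℝ, 0 < ρ → ρ < ε →
      νZ (f ⁻¹' closedBall w (5 * ρ)) ≤ K * νW (closedBall w ρ) := by
  obtain ⟨C, hC1, hC⟩ := hf
  obtain ⟨CZ, hCZ1, -, hCZ⟩ := hZ.exists_bounds hQZ
  obtain ⟨CW, hCW1, hCW⟩ := hW
  have hC0 : 0 < C := by linarith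
  have hCZ0 : 0 < CZ := by linarith
  have hCW0 : 0 < CW := by linarith
  set M : ℝ := CZ * (2 * (C * 5) ^ θ₁⁻¹) ^ QZ with hM
  refine ⟨ENNReal.ofReal (M * CW), (ENNReal.ofReal_pos.2 (by positivity)).ne',
    ENNReal.ofReal_ne_top, fun w => ?_⟩
  -- The Hölder bounds hold only within distance r in Z; openness of f guarantees this for preimages
  -- of points near w, with ε depending on w.
  have hopen : f '' ball (f.symm w) r ∈ nhds w :=
    (f.isOpenMap _ isOpen_ball).mem_nhds ⟨f.symm w, mem_ball_self hr, f.apply_symm_apply w⟩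
  obtain ⟨ε, hε, hεs⟩ := Metric.mem_nhds_iff.1 hopen
  have hpos : 0 < 2 * ediam (univ : Set W) :=
    ENNReal.mul_pos (by simp) (ediam_pos_iff.2 nontrivial_univ).ne'
  obtain ⟨D, hD0, hD⟩ := exists_between hpos
  have hDt : D ≠ ∞ := hD.ne_top
  have hD0' := ENNReal.toReal_pos hD0.ne' hDt
  -- ε / 5 keeps the enlarged ball within reach of the Hölder bound, 1 allows powers of ρ to be
  -- compared by exponent, and D keeps ρ in the range of regularity of W.
  refine ⟨min (ε / 5) (min 1 D.toReal), by positivity, fun ρ hρ hρε => ?_⟩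
  simp only [lt_min_iff] at hρε
  obtain ⟨hρε, hρ1, hρD⟩ := hρε
  have hsub : f ⁻¹' closedBall w (5 * ρ) ⊆ ball (f.symm w) (2 * (C * (5 * ρ)) ^ θ₁⁻¹) := by
    intro y hy
    have hy' : dist (f y) w ≤ 5 * ρ := hy
    obtain ⟨z, hz, hzy⟩ := hεs (mem_ball.2 (by linarith : dist (f y) w < ε))
    obtain rfl : z = y := f.injective hzy
    have h1 := (hC z (f.symm w) hz).1
    rw [f.apply_symm_apply] at h1
    have h2 : dist z (f.symm w) ^ θ₁ ≤ C * (5 * ρ) := by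
      rw [inv_mul_le_iff₀ hC0] at h1
      exact h1.trans (by gcongr)
    have h3 : dist z (f.symm w) ≤ (C * (5 * ρ)) ^ θ₁⁻¹ :=
      (Real.le_rpow_inv_iff_of_pos dist_nonneg (by positivity) hθ₁).2 h2
    have h4 : 0 < (C * (5 * ρ)) ^ θ₁⁻¹ := by positivity
    rw [mem_ball]
    linarith
  have hlow : ENNReal.ofReal (CW⁻¹ * ρ ^ QW) ≤ νW (closedBall w ρ) := by
    refine ((hCW w ρ hρ ?_).1).trans (measure_mono ball_subset_closedBall)
    refine lt_of_le_of_lt ?_ hD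
    rw [← ENNReal.ofReal_toReal hDt]
    exact ENNReal.ofReal_le_ofReal hρD.le
  calc νZ (f ⁻¹' closedBall w (5 * ρ))
      ≤ ENNReal.ofReal (CZ * (2 * (C * (5 * ρ)) ^ θ₁⁻¹) ^ QZ) :=
        (measure_mono hsub).trans (hCZ _ _ (by positivity))
    _ ≤ ENNReal.ofReal (M * CW * (CW⁻¹ * ρ ^ QW)) := by
        apply ENNReal.ofReal_le_ofReal
        have e1 : CZ * (2 * (C * (5 * ρ)) ^ θ₁⁻¹) ^ QZ = M * ρ ^ (θ₁⁻¹ * QZ) := by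
          rw [hM, ← mul_assoc C, Real.mul_rpow (by positivity) hρ.le, ← mul_assoc 2,
            Real.mul_rpow (by positivity) (by positivity), ← Real.rpow_mul hρ.le, mul_assoc]
        have e2 : M * CW * (CW⁻¹ * ρ ^ QW) = M * ρ ^ QW := by field_simp
        rw [e1, e2]
        have : ρ ^ (θ₁⁻¹ * QZ) ≤ ρ ^ QW :=
          Real.rpow_le_rpow_of_exponent_ge hρ hρ1.le (by rwa [le_inv_mul_iff₀ hθ₁])
        gcongr
    _ = ENNReal.ofReal (M * CW) * ENNReal.ofReal (CW⁻¹ * ρ ^ QW) :=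
        ENNReal.ofReal_mul (by positivity)
    _ ≤ ENNReal.ofReal (M * CW) * νW (closedBall w ρ) := by gcongr

/-- The push-forward of `νZ` is dominated by a multiple of `νW`. -/
theorem IsLocallyBiHolder.exists_map_le_smul [BorelSpace Z] [BorelSpace W]
    (hf : IsLocallyBiHolder f θ₁ θ₂ r) (hr : 0 < r) (hQZ : 0 < QZ) (hθ₁ : 0 < θ₁)
    (hQ : θ₁ * QW ≤ QZ) (hZ : IsAhlforsRegular νZ QZ) (hW : IsAhlforsRegular νW QW) :
    ∃ K : ℝ≥0∞, K ≠ ∞ ∧ νZ.map f ≤ K • νW := by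
  obtain ⟨K, hK0, hK, hball⟩ :=
    hf.exists_measure_preimage_closedBall_le hr hQZ hθ₁ hQ hZ hW
  choose ε hε hball using hball
  refine ⟨K, hK, ?_⟩
  have := hW.secondCountableTopology
  have : IsLocallyFiniteMeasure νW :=
    ⟨fun w => ⟨ball w 1, ball_mem_nhds w one_pos, hW.measure_ball_lt_top w 1⟩⟩
  have hopen : ∀ U : Set W, IsOpen U → νZ (f ⁻¹' U) ≤ K * νW U := by
    intro U hU
    have hρ : ∀ w : U, ∃ ρ : ℝ, 0 < ρ ∧ ρ < ε w ∧ ρ ≤ 1 ∧ closedBall (w : W) ρ ⊆ U := by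
      intro w
      obtain ⟨δ, hδ, hδU⟩ := nhds_basis_closedBall.mem_iff.1 (hU.mem_nhds w.2)
      have h1 := min_le_left (ε w / 2) (min 1 δ)
      have h2 := min_le_right (ε w / 2) (min 1 δ)
      refine ⟨min (ε w / 2) (min 1 δ), lt_min (half_pos (hε w)) (by positivity), ?_,
        h2.trans (min_le_left _ _),
        (closedBall_subset_closedBall (h2.trans (min_le_right _ _))).trans hδU⟩
      linarith [hε w]
    choose ρ hρ0 hρε hρ1 hρU using hρ
    -- The enlargement factor 5 is the one built into the ball estimate; the original balls stay
    -- disjoint inside U, so their measures sum to at most that of U.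
    obtain ⟨t, -, hdisj, hcov⟩ := Vitali.exists_disjoint_subfamily_covering_enlargement_closedBall
      (univ : Set U) (fun w => (w : W)) ρ 1 (fun w _ => hρ1 w) 5 (by norm_num)
    have ht : t.Countable := by
      refine hdisj.countable_of_nonempty_interior fun w _ => ⟨w, ?_⟩
      exact ball_subset_interior_closedBall (mem_ball_self (hρ0 w))
    have hsub : f ⁻¹' U ⊆ ⋃ w ∈ t, f ⁻¹' closedBall (w : W) (5 * ρ w) := by
      intro z hz
      obtain ⟨b, hb, hb'⟩ := hcov ⟨f z, hz⟩ (mem_univ _)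
      exact mem_iUnion₂.2 ⟨b, hb, hb' (mem_closedBall_self (hρ0 _).le)⟩
    calc νZ (f ⁻¹' U) ≤ ∑' w : t, νZ (f ⁻¹' closedBall (w : W) (5 * ρ w)) :=
          (measure_mono hsub).trans (measure_biUnion_le νZ ht _)
      _ ≤ ∑' w : t, K * νW (closedBall (w : W) (ρ w)) :=
          ENNReal.tsum_le_tsum fun w => hball _ _ (hρ0 w) (hρε w)
      _ = K * νW (⋃ w ∈ t, closedBall (w : W) (ρ w)) := by
          rw [ENNReal.tsum_mul_left, measure_biUnion ht hdisj
            fun w _ => isClosed_closedBall.measurableSet]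
      _ ≤ K * νW U := by
          gcongr
          exact iUnion₂_subset fun w _ => hρU w
  -- Outer regularity of `νW` reduces Borel sets to open ones; dividing by K uses K ≠ 0.
  rw [Measure.le_iff]
  intro A hA
  rw [Measure.map_apply f.continuous.measurable hA, Measure.smul_apply, smul_eq_mul,
    mul_comm,
    ← ENNReal.div_le_iff_le_mul (Or.inl hK0) (Or.inl hK), A.measure_eq_iInf_isOpen νW]
  refine le_iInf₂ fun U hAU => le_iInf fun hU => ?_
  exact ENNReal.div_le_of_le_mul' ((measure_mono (preimage_mono hAU)).trans (hopen U hU))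

end MapLe

/-! ### Integral inequalities. -/

/-- As f is a measurable equivalence, the change of variables needs no measurability of g, so it
applies freely to inner integrals. -/
theorem lintegral_comp_le_of_map_le {Z W : Type*} [TopologicalSpace Z] [MeasurableSpace Z]
    [BorelSpace Z] [TopologicalSpace W] [MeasurableSpace W] [BorelSpace W] {νZ : Measure Z}
    {νW : Measure W} {f : Z ≃ₜ W} {K : ℝ≥0∞} (h : νZ.map f ≤ K • νW) (g : W → ℝ≥0∞) :
    ∫⁻ z, g (f z) ∂νZ ≤ K * ∫⁻ w, g w ∂νW := by
  calc ∫⁻ z, g (f z) ∂νZ = ∫⁻ w, g w ∂(νZ.map f) :=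
        (lintegral_map_equiv g f.toMeasurableEquiv).symm
    _ ≤ ∫⁻ w, g w ∂(K • νW) := lintegral_mono' h le_rfl
    _ = K * ∫⁻ w, g w ∂νW := by rw [lintegral_smul_measure, smul_eq_mul]

/-- Schur-type bound for a symmetric kernel. -/
theorem lintegral_lintegral_add_mul_le {Z : Type*} [MeasurableSpace Z] {ν : Measure Z} [SFinite ν]
    {a : Z → ℝ≥0∞} (ha : Measurable a) {k : Z → Z → ℝ≥0∞} (hk : Measurable (Function.uncurry k))
    (hsymm : ∀ x y, k x y = k y x) {K : ℝ≥0∞} (hK : ∀ y, ∫⁻ x, k x y ∂ν ≤ K) :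
    ∫⁻ y, ∫⁻ x, (a x + a y) * k x y ∂ν ∂ν ≤ 2 * K * ∫⁻ x, a x ∂ν := by
  have hky : ∀ y, Measurable fun x => k x y := fun y => hk.comp measurable_prodMk_right
  have hdiag : ∫⁻ y, ∫⁻ x, a y * k x y ∂ν ∂ν ≤ K * ∫⁻ x, a x ∂ν := by
    rw [← lintegral_const_mul _ ha]
    refine lintegral_mono fun y => ?_
    rw [lintegral_const_mul _ (hky y), mul_comm]
    gcongr
    exact hK y
  have hm : Measurable (Function.uncurry fun y x => a x * k x y) :=
    (ha.comp measurable_snd).mul (hk.comp measurable_swap)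
  -- Tonelli and the symmetry of k.
  have hswap : ∫⁻ y, ∫⁻ x, a x * k x y ∂ν ∂ν = ∫⁻ y, ∫⁻ x, a y * k x y ∂ν ∂ν := by
    rw [lintegral_lintegral_swap hm.aemeasurable]
    simp only [hsymm]
  calc ∫⁻ y, ∫⁻ x, (a x + a y) * k x y ∂ν ∂ν
      = ∫⁻ y, (∫⁻ x, a x * k x y ∂ν + ∫⁻ x, a y * k x y ∂ν) ∂ν := by
        refine lintegral_congr fun y => ?_
        simp only [add_mul]
        exact lintegral_add_left (ha.mul (hky y)) _
    _ = ∫⁻ y, ∫⁻ x, a x * k x y ∂ν ∂ν + ∫⁻ y, ∫⁻ x, a y * k x y ∂ν ∂ν :=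
        lintegral_add_left hm.lintegral_prod_right' _
    _ ≤ 2 * K * ∫⁻ x, a x ∂ν := by
        rw [hswap, mul_assoc, two_mul]
        gcongr

/-- Integrated form of a pointwise bound by a pulled back function and a symmetric kernel. -/
theorem lintegral_lintegral_le_of_map_le {Z W : Type*} [TopologicalSpace Z] [MeasurableSpace Z]
    [BorelSpace Z] [TopologicalSpace W] [MeasurableSpace W] [BorelSpace W] {νZ : Measure Z}
    [SFinite νZ] {νW : Measure W} {f : Z ≃ₜ W} {K K₁ K₂ T : ℝ≥0∞} (hK : K ≠ ∞) (hK₁ : K₁ ≠ ∞)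
    (hK₂ : K₂ ≠ ∞) (hmap : νZ.map f ≤ K • νW) {F k : Z → Z → ℝ≥0∞} {G : W → W → ℝ≥0∞}
    {b : W → ℝ≥0∞} (hb : Measurable b) (hk : Measurable (Function.uncurry k))
    (hsymm : ∀ x y, k x y = k y x) (hT : ∀ y, ∫⁻ x, k x y ∂νZ ≤ T)
    (hF : ∀ x y, F x y ≤ K₁ * G (f x) (f y) + K₂ * ((b (f x) + b (f y)) * k x y)) :
    ∫⁻ y, ∫⁻ x, F x y ∂νZ ∂νZ ≤ (K₁ * (K * K) + K₂ * (2 * T) * K) *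
      (∫⁻ w, b w ∂νW + ∫⁻ y, ∫⁻ x, G x y ∂νW ∂νW) := by
  have ha : Measurable fun x => b (f x) := hb.comp f.continuous.measurable
  have hm : Measurable (Function.uncurry fun y x => K₂ * ((b (f x) + b (f y)) * k x y)) :=
    (((ha.comp measurable_snd).add (ha.comp measurable_fst)).mul
      (hk.comp measurable_swap)).const_mul _
  have hmy : ∀ y, Measurable fun x => K₂ * ((b (f x) + b (f y)) * k x y) := fun y =>
    hm.comp measurable_prodMk_left
  have hmint : Measurable fun y => ∫⁻ x, K₂ * ((b (f x) + b (f y)) * k x y) ∂νZ :=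
    hm.lintegral_prod_right'
  have hGint : ∫⁻ y, ∫⁻ x, G (f x) (f y) ∂νZ ∂νZ ≤ K * K * ∫⁻ y, ∫⁻ x, G x y ∂νW ∂νW := by
    calc ∫⁻ y, ∫⁻ x, G (f x) (f y) ∂νZ ∂νZ
        ≤ ∫⁻ y, K * ∫⁻ x, G x (f y) ∂νW ∂νZ :=
          lintegral_mono fun y => lintegral_comp_le_of_map_le hmap fun x => G x (f y)
      _ = K * ∫⁻ y, ∫⁻ x, G x (f y) ∂νW ∂νZ := lintegral_const_mul' _ _ hK
      _ ≤ K * (K * ∫⁻ y, ∫⁻ x, G x y ∂νW ∂νW) := by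
          gcongr
          exact lintegral_comp_le_of_map_le hmap fun y => ∫⁻ x, G x y ∂νW
      _ = _ := by rw [mul_assoc]
  calc ∫⁻ y, ∫⁻ x, F x y ∂νZ ∂νZ
      ≤ ∫⁻ y, ∫⁻ x, (K₁ * G (f x) (f y) + K₂ * ((b (f x) + b (f y)) * k x y)) ∂νZ ∂νZ :=
        lintegral_mono fun y => lintegral_mono fun x => hF x y
    _ = ∫⁻ y, (K₁ * ∫⁻ x, G (f x) (f y) ∂νZ +
          ∫⁻ x, K₂ * ((b (f x) + b (f y)) * k x y) ∂νZ) ∂νZ := by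
        refine lintegral_congr fun y => ?_
        rw [← lintegral_const_mul' _ _ hK₁]
        exact lintegral_add_right _ (hmy y)
    _ = K₁ * ∫⁻ y, ∫⁻ x, G (f x) (f y) ∂νZ ∂νZ +
          K₂ * ∫⁻ y, ∫⁻ x, (b (f x) + b (f y)) * k x y ∂νZ ∂νZ := by
        rw [lintegral_add_right _ hmint, lintegral_const_mul' _ _ hK₁]
        simp only [lintegral_const_mul' _ _ hK₂]
    _ ≤ K₁ * (K * K * ∫⁻ y, ∫⁻ x, G x y ∂νW ∂νW) +
          K₂ * (2 * T * (K * ∫⁻ w, b w ∂νW)) := by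
        refine add_le_add (mul_le_mul_right hGint _) (mul_le_mul_right ?_ _)
        exact (lintegral_lintegral_add_mul_le ha hk hsymm hT).trans
          (mul_le_mul_right (lintegral_comp_le_of_map_le hmap b) _)
    _ = K₁ * (K * K) * ∫⁻ y, ∫⁻ x, G x y ∂νW ∂νW + K₂ * (2 * T) * K * ∫⁻ w, b w ∂νW := by
        ring
    _ ≤ _ := by
        rw [add_mul]
        exact add_le_add (mul_le_mul_right le_add_self _) (mul_le_mul_right le_self_add _)

theorem ofReal_abs_sub_rpow_le {p : ℝ} (hp : 1 ≤ p) (a b : ℝ) :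
    ENNReal.ofReal |a - b| ^ p ≤
      2 ^ (p - 1) * (ENNReal.ofReal |a| ^ p + ENNReal.ofReal |b| ^ p) := by
  refine le_trans ?_ (ENNReal.rpow_add_le_mul_rpow_add_rpow _ _ hp)
  rw [← ENNReal.ofReal_add (abs_nonneg a) (abs_nonneg b)]
  gcongr
  exact abs_sub a b

/-! ### Boundedness of the Besov seminorm under composition. -/

section Energy

variable {Z W : Type*} [MetricSpace Z] [MeasurableSpace Z]
  [MetricSpace W] [MeasurableSpace W]
  {νZ : Measure Z} {νW : Measure W} {QZ QW θ₁ θ₂ s s' p r : ℝ} {f : Z ≃ₜ W}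

/-- The Besov kernel on `Z` is controlled, near the diagonal, by that on `W`. -/
theorem IsLocallyBiHolder.exists_kernel_le (hf : IsLocallyBiHolder f θ₁ θ₂ r)
    (hZ : IsAhlforsRegular νZ QZ) (hW : IsAhlforsRegular νW QW) {α β : ℝ} (hβ : 0 ≤ β + QW)
    (h : α + QZ ≤ θ₂ * (β + QW)) :
    ∃ K : ℝ≥0∞, K ≠ ∞ ∧ ∀ (a : ℝ≥0∞) (x y : Z), x ≠ y → dist x y < r →
      a / edist x y ^ α / νZ (ball x (dist x y)) ≤
        K * (a / edist (f x) (f y) ^ β / νW (ball (f x) (dist (f x) (f y)))) := by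
  obtain ⟨C, hC1, hC⟩ := hf
  obtain ⟨CZ, hCZ1, hCZ⟩ := hZ.exists_kernel_bounds
  obtain ⟨CW, hCW1, hCW⟩ := hW.exists_kernel_bounds
  have hC0 : 0 < C := by linarith
  have hCZ0 : 0 < CZ := by linarith
  have hCW0 : 0 < CW := by linarith
  -- The power of r absorbs the surplus exponent, which is nonnegative by `h`, since d(x, y) < r.
  refine ⟨ENNReal.ofReal (CZ * CW * C ^ (β + QW) * r ^ (θ₂ * (β + QW) - (α + QZ))),
    ENNReal.ofReal_ne_top, fun a x y hxy hd => ?_⟩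
  have hd0 : 0 < dist x y := dist_pos.2 hxy
  have hr : 0 < r := hd0.trans hd
  have hw0 : 0 < dist (f x) (f y) := dist_pos.2 (f.injective.ne hxy)
  refine ((hCZ a α x y hxy).2).trans (le_trans ?_
    (mul_le_mul_right (hCW a β (f x) (f y) (f.injective.ne hxy)).1 _))
  rw [mul_left_comm, ← ENNReal.ofReal_mul (by positivity)]
  refine mul_le_mul_right (ENNReal.ofReal_le_ofReal ?_) _
  have h1 : C ^ (-(β + QW)) * dist x y ^ (-(θ₂ * (β + QW))) ≤
      dist (f x) (f y) ^ (-(β + QW)) := by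
    rw [← mul_neg, Real.rpow_mul hd0.le, ← Real.mul_rpow hC0.le (by positivity)]
    exact Real.rpow_le_rpow_of_nonpos hw0 (hC x y hd).2 (by linarith)
  have h2 : dist x y ^ (-(α + QZ)) ≤
      r ^ (θ₂ * (β + QW) - (α + QZ)) * dist x y ^ (-(θ₂ * (β + QW))) := by
    have : dist x y ^ (-(α + QZ)) =
        dist x y ^ (θ₂ * (β + QW) - (α + QZ)) * dist x y ^ (-(θ₂ * (β + QW))) := by
      rw [← Real.rpow_add hd0]
      congr 1
      ring
    rw [this]
    gcongr
  calc CZ * dist x y ^ (-(α + QZ))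
      ≤ CZ * (r ^ (θ₂ * (β + QW) - (α + QZ)) * dist x y ^ (-(θ₂ * (β + QW)))) := by gcongr
    _ = CZ * CW * C ^ (β + QW) * r ^ (θ₂ * (β + QW) - (α + QZ)) *
          (CW⁻¹ * (C ^ (-(β + QW)) * dist x y ^ (-(θ₂ * (β + QW))))) := by
        rw [Real.rpow_neg hC0.le]
        field_simp
    _ ≤ _ := by gcongr

variable [BorelSpace Z] [Nontrivial Z] [BorelSpace W]

/-- Bound for the double integral defining the Besov seminorm of a composition. -/
theorem IsLocallyBiHolder.exists_lintegral_besov_comp_le (hf : IsLocallyBiHolder f θ₁ θ₂ r)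
    (hr : 0 < r) (hZ : IsAhlforsRegular νZ QZ) (hW : IsAhlforsRegular νW QW)
    (hQZ : 0 < QZ) (hQW : 0 < QW) (hs : 0 < s) (hs' : 0 < s') (hp : 1 ≤ p)
    (h : s' * p + QZ ≤ θ₂ * (s * p + QW)) {K : ℝ≥0∞} (hK : K ≠ ∞) (hmap : νZ.map f ≤ K • νW) :
    ∃ M : ℝ≥0∞, M ≠ ∞ ∧ ∀ u : W → ℝ, Measurable u →
      ∫⁻ y, ∫⁻ x, ENNReal.ofReal |u (f x) - u (f y)| ^ p / edist x y ^ (s' * p) /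
          νZ (ball x (dist x y)) ∂νZ ∂νZ ≤
        M * (∫⁻ w, ENNReal.ofReal |u w| ^ p ∂νW +
          ∫⁻ y, ∫⁻ x, ENNReal.ofReal |u x - u y| ^ p / edist x y ^ (s * p) /
            νW (ball x (dist x y)) ∂νW ∂νW) := by
  have hp0 : 0 < p := by linarith
  have := hZ.sigmaFinite
  have := hZ.secondCountableTopology
  obtain ⟨K₁, hK₁, hnear⟩ := hf.exists_kernel_le hZ hW (by positivity) h
  obtain ⟨C, hC1, hC⟩ := hZ.exists_kernel_bounds
  obtain ⟨T, hT, htail⟩ := hZ.exists_tail_bound hQZ (mul_pos hs' hp0) hr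
  have hC0 : 0 < C := by linarith
  let K₂ : ℝ≥0∞ := 2 ^ (p - 1) * ENNReal.ofReal C
  have hK₂ : K₂ ≠ ∞ := ENNReal.mul_ne_top
    (ENNReal.rpow_ne_top_of_nonneg (by linarith) (by simp)) ENNReal.ofReal_ne_top
  -- The kernel of Z, up to constants, cut off to distances at least r.
  let k : Z → Z → ℝ≥0∞ := fun x y =>
    {z : Z | r ≤ dist z y}.indicator (fun z => ENNReal.ofReal (dist z y ^ (-(s' * p + QZ)))) x
  have hk : Measurable (Function.uncurry k) := by
    have hs : MeasurableSet {q : Z × Z | r ≤ dist q.1 q.2} :=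
      measurableSet_le (by fun_prop) (by fun_prop)
    exact Measurable.indicator
      (f := fun q : Z × Z => ENNReal.ofReal (dist q.1 q.2 ^ (-(s' * p + QZ)))) (by fun_prop) hs
  have hsymm : ∀ x y, k x y = k y x := by
    intro x y
    simp only [k, indicator, mem_ofPred_eq, dist_comm x y]
  have hkT : ∀ y, ∫⁻ x, k x y ∂νZ ≤ T := by
    intro y
    rw [lintegral_indicator (measurableSet_le (by fun_prop) (by fun_prop))]
    exact htail y
  refine ⟨K₁ * (K * K) + K₂ * (2 * T) * K, by finiteness, fun u hu => ?_⟩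
  have hb : Measurable fun w => ENNReal.ofReal |u w| ^ p := by fun_prop
  refine lintegral_lintegral_le_of_map_le hK hK₁ hK₂ hmap hb hk hsymm hkT fun x y => ?_
  rcases eq_or_ne x y with rfl | hxy
  · simp [ENNReal.zero_rpow_of_pos hp0]
  rcases lt_or_ge (dist x y) r with hd | hd
  · exact (hnear _ x y hxy hd).trans le_self_add
  · refine le_trans ?_ le_add_self
    refine ((hC _ _ x y hxy).2).trans ?_
    have hkxy : k x y = ENNReal.ofReal (dist x y ^ (-(s' * p + QZ))) :=
      indicator_of_mem (by exact hd) _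
    rw [hkxy, ENNReal.ofReal_mul hC0.le]
    refine (mul_le_mul_left (ofReal_abs_sub_rpow_le hp _ _) _).trans_eq ?_
    simp only [K₂]
    ring

/-- Composition with `f` is bounded from `B^s_{p,p}(W)` to the homogeneous Besov space on `Z`. -/
theorem IsLocallyBiHolder.exists_besovSeminorm_comp_le (hf : IsLocallyBiHolder f θ₁ θ₂ r)
    (hr : 0 < r) (hZ : IsAhlforsRegular νZ QZ) (hW : IsAhlforsRegular νW QW)
    (hQZ : 0 < QZ) (hQW : 0 < QW) (hs : 0 < s) (hs' : 0 < s') (hp : 1 ≤ p)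
    (h : s' * p + QZ ≤ θ₂ * (s * p + QW)) {K : ℝ≥0∞} (hK : K ≠ ∞) (hmap : νZ.map f ≤ K • νW) :
    ∃ M : ℝ≥0∞, M ≠ ∞ ∧ ∀ u : W → ℝ, Measurable u →
      besovSeminorm s' p νZ (u ∘ f) ≤
        M * (eLpNorm u (ENNReal.ofReal p) νW + besovSeminorm s p νW u) := by
  have hp0 : 0 < p := by linarith
  obtain ⟨M, hM, hle⟩ :=
    hf.exists_lintegral_besov_comp_le hr hZ hW hQZ hQW hs hs' hp h hK hmap
  refine ⟨M ^ (1 / p), ENNReal.rpow_ne_top_of_nonneg (by positivity) hM, fun u hu => ?_⟩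
  have hLp : eLpNorm u (ENNReal.ofReal p) νW =
      (∫⁻ w, ENNReal.ofReal |u w| ^ p ∂νW) ^ (1 / p) := by
    rw [eLpNorm_eq_lintegral_rpow_enorm_toReal (by simpa using hp0) ENNReal.ofReal_ne_top,
      ENNReal.toReal_ofReal hp0.le]
    simp only [Real.enorm_eq_ofReal_abs]
  rw [hLp, besovSeminorm, besovSeminorm]
  calc _ ≤ (M * _) ^ (1 / p) := ENNReal.rpow_le_rpow (hle u hu) (by positivity)
    _ = M ^ (1 / p) * _ := ENNReal.mul_rpow_of_nonneg _ _ (by positivity)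
    _ ≤ _ := by
        gcongr
        exact ENNReal.rpow_add_le_add_rpow _ _ (by positivity)
          ((div_le_one hp0).2 hp)

end Energy

/-! ### Injectivity by blow-up at a point. -/

section Injective

variable {Z W : Type*} [MetricSpace Z] [MeasurableSpace Z] [BorelSpace Z]
  [MetricSpace W] [MeasurableSpace W] [BorelSpace W]
  {νZ : Measure Z} {νW : Measure W} {QZ QW θ₁ θ₂ s s' p r : ℝ} {f : Z ≃ₜ W}

/-- If the Besov integral of `u` converges at the point `f x` and `u ∘ f` vanishes almost
everywhere, then `u` vanishes at `f x`. -/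
theorem IsLocallyBiHolder.eq_zero_of_lintegral_ne_top (hf : IsLocallyBiHolder f θ₁ θ₂ r)
    (hr : 0 < r) (hr' : ENNReal.ofReal r < 2 * ediam (univ : Set Z))
    (hZ : IsAhlforsRegular νZ QZ) (hθ₂ : 0 < θ₂) {β : ℝ} (hβ : 0 ≤ β) (h : QZ < θ₂ * β)
    {K : ℝ≥0∞} (hK : K ≠ ∞) (hmap : νZ.map f ≤ K • νW) {u : W → ℝ}
    (hu0 : ∀ᵐ z ∂νZ, u (f z) = 0) {x : Z}
    (hx : ∫⁻ w, ENNReal.ofReal |u w - u (f x)| ^ p *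
      ENNReal.ofReal (dist w (f x) ^ (-β)) ∂νW ≠ ∞) :
    u (f x) = 0 := by
  by_contra hne
  obtain ⟨C, hC1, hC⟩ := hf
  obtain ⟨CZ, hCZ1, hCZ⟩ := hZ
  have hC0 : 0 < C := by linarith
  have hCZ0 : 0 < CZ := by linarith
  have hpos : 0 < |u (f x)| := abs_pos.2 hne
  set c : ℝ := |u (f x)| ^ p * C ^ (-β) * CZ⁻¹ with hc
  have hc0 : 0 < c := by positivity
  set I := K * ∫⁻ w, ENNReal.ofReal |u w - u (f x)| ^ p *
      ENNReal.ofReal (dist w (f x) ^ (-β)) ∂νW with hI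
  have hItop : I ≠ ∞ := ENNReal.mul_ne_top hK hx
  have key : ∀ t : ℝ, 0 < t → t < r → c * t ^ (-(θ₂ * β - QZ)) ≤ I.toReal := by
    intro t ht htr
    rw [← ENNReal.ofReal_le_iff_le_toReal hItop]
    have htd : ENNReal.ofReal t < 2 * ediam (univ : Set Z) :=
      (ENNReal.ofReal_le_ofReal htr.le).trans_lt hr'
    calc ENNReal.ofReal (c * t ^ (-(θ₂ * β - QZ)))
        = ENNReal.ofReal (|u (f x)| ^ p * (C * t ^ θ₂) ^ (-β)) *
            ENNReal.ofReal (CZ⁻¹ * t ^ QZ) := by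
          rw [← ENNReal.ofReal_mul (by positivity), Real.mul_rpow hC0.le (by positivity),
            ← Real.rpow_mul ht.le]
          have : t ^ (-(θ₂ * β - QZ)) = t ^ (θ₂ * -β) * t ^ QZ := by
            rw [← Real.rpow_add ht]
            congr 1
            ring
          rw [this, hc]
          congr 1
          ring
      _ ≤ ENNReal.ofReal (|u (f x)| ^ p * (C * t ^ θ₂) ^ (-β)) * νZ (ball x t) := by
          gcongr
          exact (hCZ x t ht htd).1
      _ = ∫⁻ _ in ball x t, ENNReal.ofReal (|u (f x)| ^ p * (C * t ^ θ₂) ^ (-β)) ∂νZ :=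
          (setLIntegral_const _ _).symm
      _ ≤ ∫⁻ z in ball x t, ENNReal.ofReal |u (f z) - u (f x)| ^ p *
            ENNReal.ofReal (dist (f z) (f x) ^ (-β)) ∂νZ := by
          refine setLIntegral_mono_ae' isOpen_ball.measurableSet ?_
          filter_upwards [hu0] with z hz hzt
          -- Since u vanishes at f z but not at f x, the point x itself, where the real power takes
          -- a default value, is excluded.
          have hzx : f z ≠ f x := fun e => hne (e ▸ hz)
          have hdw : 0 < dist (f z) (f x) := dist_pos.2 hzx
          have hdz : 0 < dist z x := dist_pos.2 fun e => hzx (e ▸ rfl)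
          rw [hz, zero_sub, abs_neg, ENNReal.ofReal_rpow_of_pos hpos,
            ← ENNReal.ofReal_mul (by positivity)]
          refine ENNReal.ofReal_le_ofReal (mul_le_mul_of_nonneg_left ?_ (by positivity))
          refine Real.rpow_le_rpow_of_nonpos hdw ?_ (by linarith)
          refine (hC z x (lt_trans hzt htr)).2.trans ?_
          have : dist z x ≤ t := (mem_ball.1 hzt).le
          gcongr
      _ ≤ ∫⁻ z, ENNReal.ofReal |u (f z) - u (f x)| ^ p *
            ENNReal.ofReal (dist (f z) (f x) ^ (-β)) ∂νZ := setLIntegral_le_lintegral _ _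
      _ ≤ I := lintegral_comp_le_of_map_le hmap fun w => ENNReal.ofReal |u w - u (f x)| ^ p *
            ENNReal.ofReal (dist w (f x) ^ (-β))
  have hlim := (tendsto_rpow_neg_nhdsGT_zero (y := -(θ₂ * β - QZ)) (by linarith)).const_mul_atTop
    hc0
  obtain ⟨t, ht, ht0, htr⟩ := ((hlim.eventually_gt_atTop I.toReal).and
    (Ioo_mem_nhdsGT hr)).exists
  exact (key t ht0 htr).not_gt ht

/-- A Besov function on `W` is determined by its composition with `f` up to null sets, although
`f` need not map null sets to null sets. -/
theorem IsLocallyBiHolder.ae_eq_zero_of_comp [Nontrivial W] (hf : IsLocallyBiHolder f θ₁ θ₂ r)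
    (hr : 0 < r) (hr' : ENNReal.ofReal r < 2 * ediam (univ : Set Z))
    (hZ : IsAhlforsRegular νZ QZ) (hW : IsAhlforsRegular νW QW) (hp : 0 < p) (hθ₂ : 0 < θ₂)
    (hβ : 0 ≤ s * p + QW)
    (h : QZ < θ₂ * (s * p + QW)) {K : ℝ≥0∞} (hK : K ≠ ∞) (hmap : νZ.map f ≤ K • νW)
    {u : W → ℝ} (hu : Measurable u) (hfin : besovSeminorm s p νW u ≠ ∞)
    (hu0 : ∀ᵐ z ∂νZ, u (f z) = 0) : ∀ᵐ w ∂νW, u w = 0 := by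
  have := hW.sigmaFinite
  have := hW.secondCountableTopology
  obtain ⟨C, hC1, hC⟩ := hW.exists_kernel_bounds
  have hC0 : 0 < C := by linarith
  have hE : ∫⁻ y, ∫⁻ x, ENNReal.ofReal |u x - u y| ^ p / edist x y ^ (s * p) /
      νW (ball x (dist x y)) ∂νW ∂νW ≠ ∞ := by
    intro htop
    rw [besovSeminorm, htop, ENNReal.top_rpow_of_pos (by positivity)] at hfin
    exact hfin rfl
  have hle : ∫⁻ y, ∫⁻ x, ENNReal.ofReal |u x - u y| ^ p *
      ENNReal.ofReal (dist x y ^ (-(s * p + QW))) ∂νW ∂νW ≤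
      ENNReal.ofReal C * ∫⁻ y, ∫⁻ x, ENNReal.ofReal |u x - u y| ^ p / edist x y ^ (s * p) /
        νW (ball x (dist x y)) ∂νW ∂νW := by
    rw [← lintegral_const_mul' _ _ ENNReal.ofReal_ne_top]
    refine lintegral_mono fun y => ?_
    rw [← lintegral_const_mul' _ _ ENNReal.ofReal_ne_top]
    refine lintegral_mono fun x => ?_
    rcases eq_or_ne x y with rfl | hxy
    · simp [ENNReal.zero_rpow_of_pos hp]
    refine le_trans (le_of_eq ?_) (mul_le_mul_right (hC _ _ x y hxy).1 _)
    rw [mul_left_comm, ← ENNReal.ofReal_mul hC0.le, mul_inv_cancel_left₀ hC0.ne']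
  have hm : Measurable (Function.uncurry fun y x => ENNReal.ofReal |u x - u y| ^ p *
      ENNReal.ofReal (dist x y ^ (-(s * p + QW)))) := by
    unfold Function.uncurry
    fun_prop
  -- A finite double integral has finite inner integral at a.e. point; surjectivity of f writes that
  -- point as f x.
  have hae := ae_lt_top hm.lintegral_prod_right'
    (hle.trans_lt (ENNReal.mul_lt_top ENNReal.ofReal_lt_top hE.lt_top)).ne
  filter_upwards [hae] with w hw
  obtain ⟨x, rfl⟩ := f.surjective w
  exact hf.eq_zero_of_lintegral_ne_top hr hr' hZ hθ₂ hβ h hK hmap hu0 hw.ne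

end Injective

/-! ### The composition operator. -/

theorem theorem1p1 {Z W : Type*}
    [MetricSpace Z] [MeasurableSpace Z] [BorelSpace Z] [Nontrivial Z]
    [MetricSpace W] [MeasurableSpace W] [BorelSpace W] [Nontrivial W]
    (νZ : Measure Z) (νW : Measure W) (QZ QW : ℝ) (hQZ : 0 < QZ) (hQW : 0 < QW)
    (hZ : IsAhlforsRegular νZ QZ) (hW : IsAhlforsRegular νW QW)
    (θ₁ θ₂ s s' p : ℝ) (hθ₁ : 0 < θ₁) (hθ₂ : 0 < θ₂) (hs : 0 < s) (hs' : 0 < s') (hp : 1 ≤ p)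
    (hQ : θ₁ * QW ≤ QZ) (hss' : s' ≤ θ₂ * s + (θ₂ * QW - QZ) / p)
    (r : ℝ) (hr : 0 < r) (hr' : ENNReal.ofReal r < 2 * ediam (univ : Set Z))
    (f : Z ≃ₜ W) (hf : IsLocallyBiHolder f θ₁ θ₂ r) :
    ∃ T : BesovSpace hW s hp →L[ℝ] BesovSpace hZ s' hp,
      Function.Injective T ∧
      ∀ (u : BesovSpace hW s hp) (g : W → ℝ), g =ᵐ[νW] BesovSpace.toLp u →
        (BesovSpace.toLp (T u) : Z → ℝ) =ᵐ[νZ] g ∘ f := by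
  have hp0 : 0 < p := by linarith
  have : Fact (1 ≤ ENNReal.ofReal p) := ⟨by simpa using hp⟩
  have hexp : s' * p + QZ ≤ θ₂ * (s * p + QW) := by
    have h1 := mul_le_mul_of_nonneg_right hss' hp0.le
    rw [add_mul, div_mul_cancel₀ _ hp0.ne'] at h1
    linarith
  -- Strictness comes from s'p > 0 and drives the blow-up.
  have hexp' : QZ < θ₂ * (s * p + QW) := by
    have := mul_pos hs' hp0
    linarith
  obtain ⟨K, hK, hmap⟩ := hf.exists_map_le_smul hr hQZ hθ₁ hQ hZ hW
  obtain ⟨M, hM, hbesov⟩ :=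
    hf.exists_besovSeminorm_comp_le hr hZ hW hQZ hQW hs hs' hp hexp hK hmap
  have hfm : Measurable f := f.continuous.measurable
  -- Gives independence of the representative.
  have hac : νZ.map f ≪ νW := Measure.absolutelyContinuous_of_le_smul hmap
  have hcomp : ∀ {g₁ g₂ : W → ℝ}, g₁ =ᵐ[νW] g₂ → g₁ ∘ f =ᵐ[νZ] g₂ ∘ f := fun h =>
    ae_eq_comp hfm.aemeasurable (hac.ae_eq h)
  have hmeas : ∀ u : Lp ℝ (ENNReal.ofReal p) νW, Measurable u := fun u =>
    (Lp.stronglyMeasurable u).measurable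
  have heLp : ∀ u : Lp ℝ (ENNReal.ofReal p) νW, eLpNorm (u ∘ f) (ENNReal.ofReal p) νZ ≤
      K ^ (1 / ENNReal.ofReal p).toReal * eLpNorm u (ENNReal.ofReal p) νW := by
    intro u
    rw [← eLpNorm_map_measure (hmeas u).aestronglyMeasurable hfm.aemeasurable]
    exact (eLpNorm_mono_measure _ hmap).trans (eLpNorm_smul_measure_le _ _ _ _)
  set K' := K ^ (1 / ENNReal.ofReal p).toReal with hK'
  have hK't : K' ≠ ∞ := ENNReal.rpow_ne_top_of_nonneg ENNReal.toReal_nonneg hK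
  have hmem : ∀ u : Lp ℝ (ENNReal.ofReal p) νW, MemLp (u ∘ f) (ENNReal.ofReal p) νZ := fun u =>
    ⟨((hmeas u).comp hfm).aestronglyMeasurable,
      (heLp u).trans_lt (ENNReal.mul_lt_top hK't.lt_top (Lp.eLpNorm_lt_top u))⟩
  let L : Lp ℝ (ENNReal.ofReal p) νW →ₗ[ℝ] Lp ℝ (ENNReal.ofReal p) νZ :=
    { toFun := fun u => (hmem u).toLp _
      map_add' := fun u v => by
        rw [← MemLp.toLp_add, MemLp.toLp_eq_toLp_iff]
        exact hcomp (Lp.coeFn_add u v)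
      map_smul' := fun c u => by
        rw [RingHom.id_apply, ← MemLp.toLp_const_smul, MemLp.toLp_eq_toLp_iff]
        exact hcomp (Lp.coeFn_smul c u) }
  have hL : ∀ u, (L u : Z → ℝ) =ᵐ[νZ] u ∘ f := fun u => (hmem u).coeFn_toLp
  have hsemi : ∀ u : BesovSpace hW s hp,
      besovSeminorm s' p νZ (L (BesovSpace.toLp u)) ≤
        M * (eLpNorm (BesovSpace.toLp u) (ENNReal.ofReal p) νW +
          besovSeminorm s p νW (BesovSpace.toLp u)) := by
    intro u
    rw [besovSeminorm_congr (hL _)]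
    exact hbesov _ (hmeas _)
  have hfin : ∀ u : BesovSpace hW s hp,
      M * (eLpNorm (BesovSpace.toLp u) (ENNReal.ofReal p) νW +
          besovSeminorm s p νW (BesovSpace.toLp u)) ≠ ∞ := fun u =>
    ENNReal.mul_ne_top hM (ENNReal.add_ne_top.2
      ⟨Lp.eLpNorm_ne_top _, BesovSpace.seminorm_toLp_ne_top u⟩)
  let T₀ : BesovSpace hW s hp →ₗ[ℝ] BesovSpace hZ s' hp :=
    LinearMap.codRestrict (besovSubmodule hZ s' hp) (L ∘ₗ BesovSpace.toLp)
      fun u => (hsemi u).trans_lt (hfin u).lt_top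
  have hT₀ : ∀ u, (BesovSpace.toLp (T₀ u) : Z → ℝ) =ᵐ[νZ] BesovSpace.toLp u ∘ f := fun u =>
    hL _
  refine ⟨T₀.mkContinuous (K'.toReal + M.toReal) fun u => ?_, ?_, fun u g hg => ?_⟩
  · have h1 : ‖BesovSpace.toLp (T₀ u)‖ ≤ K'.toReal * ‖BesovSpace.toLp u‖ := by
      rw [Lp.norm_def, Lp.norm_def, ← ENNReal.toReal_mul, eLpNorm_congr_ae (hT₀ u)]
      exact ENNReal.toReal_mono (ENNReal.mul_ne_top hK't (Lp.eLpNorm_ne_top _)) (heLp _)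
    have h2 : (besovSeminorm s' p νZ (BesovSpace.toLp (T₀ u))).toReal ≤ M.toReal * ‖u‖ := by
      rw [BesovSpace.norm_def, Lp.norm_def, ← ENNReal.toReal_add (Lp.eLpNorm_ne_top _)
        (BesovSpace.seminorm_toLp_ne_top u), ← ENNReal.toReal_mul]
      exact ENNReal.toReal_mono (hfin u) (hsemi u)
    have h3 : ‖BesovSpace.toLp u‖ ≤ ‖u‖ := by
      rw [BesovSpace.norm_def]
      exact le_add_of_nonneg_right ENNReal.toReal_nonneg
    rw [BesovSpace.norm_def, add_mul]
    exact add_le_add (h1.trans (mul_le_mul_of_nonneg_left h3 ENNReal.toReal_nonneg)) h2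
  · refine (injective_iff_map_eq_zero _).2 fun u hu => ?_
    have hu' : T₀ u = 0 := hu
    have h0 := hT₀ u
    rw [hu', map_zero] at h0
    have hz : ∀ᵐ z ∂νZ, BesovSpace.toLp u (f z) = 0 := by
      filter_upwards [h0, Lp.coeFn_zero ℝ (ENNReal.ofReal p) νZ] with z h1 h2
      rw [h2] at h1
      exact h1.symm
    have hw := hf.ae_eq_zero_of_comp hr hr' hZ hW hp0 hθ₂ (by positivity) hexp' hK hmap
      (hmeas _) (BesovSpace.seminorm_toLp_ne_top u) hz
    exact Subtype.ext ((Lp.eq_zero_iff_ae_eq_zero).2 hw)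
  · exact (hT₀ u).trans (hcomp hg.symm)
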